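/- Let $T=(V,E)$ be a finite tree that is not a path, and let $d$ denote the distance in $T$. For a nonempty set $S\subseteq V$ put $d(x,S)=\min_{v\in S}d(x,v)$; the set $S$ distinguishes $x,y\in V$ if $d(x,S)\neq d(y,S)$. A $k$-partition generator of $T$ is a partition $\Pi$ of $V$ into nonempty sets such that any two different vertices are distinguished by at least $k$ members of $\Pi$, and the $k$-partition dimension $\operatorname{pd}_k(T)$ is the minimum cardinality of a $k$-partition generator of $T$. A major vertex is a vertex of degree at least $3$. For a major vertex $w$, let $U(w)$ be the set of its terminal vertices, that is, of the vertices $u$ of degree $1$ with $d(u,w)<d(u,w')$ for every major vertex $w'\neq w$. Let $\mathcal M(T)$ be the set of major vertices $w$ with $|U(w)|\ge 2$, and let $\kappa=|\mathcal M(T)|$. For $w\in\mathcal M(T)$ put $l(w)=\min_{u\in U(w)}d(u,w)$, and let $$\varsigma(T)=\min_{w\in\mathcal M(T)}\ \min_{u,v\in U(w),\,u\neq v}\bigl(d(u,w)+d(w,v)\bigr).$$ Let $l_1<l_2<\dots<l_r$ be the different values of $l(w)$, $w\in\mathcal M(T)$, and let $t_i=\max\{|U(w)| : w\in\mathcal M(T),\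 l(w)=l_i\}$. For an integer $k\ge 1$ let $s_k$ be the largest index $i$ with $l_i\le\lfloor k/2\rfloor$, and $s_k=1$ if $l_1>\lfloor k/2\rfloor$. With the convention that a maximum over an empty index set is $0$, put $$\mathcal I_k(T)=(t_1-2)\max\left\{k-l_1,\left\lceil\tfrac k2\right\rceil\right\}+\sum_{i=2}^{s_k}\max\left\{t_i-\max_{1\le j<i}t_j,\,0\right\}(k-l_i)+\max\left\{\max_{s_k<j\le r}t_j-\max_{1\le j\le s_k}t_j,\,0\right\}\left\lceil\tfrac k2\right\rceil .$$ Then, for every $k\in\{1,\dots,\varsigma(T)\}$, $T$ has a $k$-partition generator and $$\operatorname{pd}_k(T)\le k\kappa+\mathcal I_k(T)+1 .$$ -/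

import Mathlib

namespace PartDim

/-- The distance `d_G(a, S) = min_{v ∈ S} d_G(a, v)` from a vertex to a (nonempty) vertex set. -/
noncomputable def setDist {V : Type*} (G : SimpleGraph V) (a : V) (S : Set V) : ℕ :=
  sInf ((fun v => G.dist a v) '' S)

/-- The vertex set `S` distinguishes `x` and `y`. -/
def Distinguishes {V : Type*} (G : SimpleGraph V) (S : Set V) (x y : V) : Prop :=
  setDist G x S ≠ setDist G y S

/-- `P` is a `k`-partition generator of `G`: a partition of the vertex set into nonempty classes
such that any two different vertices are distinguished by at least `k` classes. -/
def IsKPartitionGenerator {V : Type*} (G : SimpleGraph V) (k : ℕ) (P : Set (Set V)) : Prop :=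
  Setoid.IsPartition P ∧
    ∀ x y : V, x ≠ y → (k : ℕ∞) ≤ {S ∈ P | Distinguishes G S x y}.encard

/-- The `k`-partition dimension: the minimum cardinality of a `k`-partition generator.
It is `⊤` exactly when there is no finite `k`-partition generator, so an upper bound by a natural
number includes the existence of a generator. -/
noncomputable def pd {V : Type*} (G : SimpleGraph V) (k : ℕ) : ℕ∞ :=
  ⨅ P ∈ {P : Set (Set V) | IsKPartitionGenerator G k P}, P.encard

section Tree

/-- A major vertex: a vertex of degree at least three. -/
def IsMajor {V : Type*} [Fintype V] (G : SimpleGraph V) [DecidableRel G.Adj] (v : V) : Prop :=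
  3 ≤ G.degree v

/-- `terminals G w` is the set `U(w)` of terminal vertices of a major vertex `w`: the end vertices
that are strictly closer to `w` than to every other major vertex. -/
def terminals {V : Type*} [Fintype V] (G : SimpleGraph V) [DecidableRel G.Adj] (w : V) : Set V :=
  {u | G.degree u = 1 ∧ ∀ w', IsMajor G w' → w' ≠ w → G.dist u w < G.dist u w'}

/-- The terminal degree of a major vertex. -/
noncomputable def ter {V : Type*} [Fintype V] (G : SimpleGraph V) [DecidableRel G.Adj]
    (w : V) : ℕ :=
  (terminals G w).ncard

/-- The set of exterior major vertices of terminal degree greater than one. -/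
def extMajor {V : Type*} [Fintype V] (G : SimpleGraph V) [DecidableRel G.Adj] : Set V :=
  {w | IsMajor G w ∧ 1 < ter G w}

/-- `l(w)`, the least length of a shortest path from `w` to one of its terminal vertices. -/
noncomputable def legLen {V : Type*} [Fintype V] (G : SimpleGraph V) [DecidableRel G.Adj]
    (w : V) : ℕ :=
  sInf ((fun z => G.dist z w) '' terminals G w)

/-- `ς(w)`, the minimum over two different terminal vertices `u, v` of `w` of the length of the
concatenation of a shortest path from `u` to `w` and one from `w` to `v`. -/
noncomputable def sigmaAt {V : Type*} [Fintype V] (G : SimpleGraph V) [DecidableRel G.Adj]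
    (w : V) : ℕ :=
  sInf {n | ∃ u ∈ terminals G w, ∃ v ∈ terminals G w, u ≠ v ∧ n = G.dist u w + G.dist w v}

/-- `ς(G)`, the minimum of `ς(w)` over all exterior major `w` of terminal degree at least two. -/
noncomputable def sigma {V : Type*} [Fintype V] (G : SimpleGraph V) [DecidableRel G.Adj] : ℕ :=
  sInf (sigmaAt G '' extMajor G)

/-- The set `{l_1 < l_2 < ⋯ < l_r}` of the values taken by `l(w)`. -/
def legLengths {V : Type*} [Fintype V] (G : SimpleGraph V) [DecidableRel G.Adj] : Set ℕ :=
  legLen G '' extMajor G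

/-- The number `r` of different values of `l(w)`. -/
noncomputable def numLevels {V : Type*} [Fintype V] (G : SimpleGraph V) [DecidableRel G.Adj] : ℕ :=
  (legLengths G).ncard

/-- `l_i`, the `i`-th smallest value of `l(w)`, for `1 ≤ i ≤ r`. -/
noncomputable def level {V : Type*} [Fintype V] (G : SimpleGraph V) [DecidableRel G.Adj]
    (i : ℕ) : ℕ :=
  Nat.nth (fun n => n ∈ legLengths G) (i - 1)

/-- `t_i`, the maximum terminal degree among the vertices with `l(w) = l_i`, for `1 ≤ i ≤ r`. -/
noncomputable def levelTer {V : Type*} [Fintype V] (G : SimpleGraph V) [DecidableRel G.Adj]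
    (i : ℕ) : ℕ :=
  sSup (ter G '' {w ∈ extMajor G | legLen G w = level G i})

open Classical in
/-- `s_k`, the maximum index `i` with `l_i ≤ ⌊k/2⌋`, and `1` if `l_1 > ⌊k/2⌋`. -/
noncomputable def cutIndex {V : Type*} [Fintype V] (G : SimpleGraph V) [DecidableRel G.Adj]
    (k : ℕ) : ℕ :=
  if level G 1 ≤ k / 2 then sSup {i | 1 ≤ i ∧ i ≤ numLevels G ∧ level G i ≤ k / 2} else 1

/-- The parameter `𝓘_k(G)`. Here `⌈k/2⌉ = (k + 1) / 2`, a maximum over an empty index set is `0`,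
and a natural-number difference `a - b` is `max (a - b) 0`. The truncation has no effect in
`t_1 - 2`, since `t_1 ≥ 2`; in `k - l_1`, since `⌈k/2⌉ ≥ 0`; and in `k - l_i` for `2 ≤ i ≤ s_k`,
since then `l_i ≤ ⌊k/2⌋`. In the other two differences it is the maximum with `0` in the
formula. -/
noncomputable def bigI {V : Type*} [Fintype V] (G : SimpleGraph V) [DecidableRel G.Adj]
    (k : ℕ) : ℕ :=
  (levelTer G 1 - 2) * max (k - level G 1) ((k + 1) / 2)
    + ∑ i ∈ Finset.Icc 2 (cutIndex G k),
        (levelTer G i - (Finset.Ico 1 i).sup (levelTer G)) * (k - level G i)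
    + ((Finset.Ioc (cutIndex G k) (numLevels G)).sup (levelTer G)
        - (Finset.Icc 1 (cutIndex G k)).sup (levelTer G)) * ((k + 1) / 2)

end Tree

end PartDim

/-!
Call `w` in `extMajor G` a centre. The part of a geodesic from a terminal vertex `u` of `w` to `w`
(without `w`) is a *leg*; as its vertices have degree at most two, it is a whole branch at `w`
(`leg_eq_side`), and the legs of all centres are disjoint (`eq_of_mem_leg`).

Number the legs at each centre from `0`, beginning with a shortest one. On the leg with index `0`
the `min (l(w)) ⌊k/2⌋` vertices nearest to `w` are coloured, on every other leg the
`max (k - l(w)) ⌈k/2⌉` nearest ones; `k ≤ ς` says that the legs are long enough. A coloured vertex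
gets as colour the index of its leg and its position on it, and, for the indices `0` and `1` only,
the name of `w`. The classes of the partition are the colour classes and the set of uncoloured
vertices.

*Number of classes* (`encard_colourClasses_le`). The legs with indices `0` and `1` use `k` colours
at each centre. A shared colour with index `i` and position `p` occurs only if `p` is at most the
quota of some `w` with more than `i` terminal vertices. The first level `l_j` with `t_j > i` has
the largest such quota, and summing over `i` gives `𝓘_k` (`sharedPairs`).

*Separation* (`le_encard_distinguishing`). Two different vertices `x`, `y` fall under one of three
cases (`separation`), found by looking at the branches at the midpoint of the path from `x` to `y`,
since a vertex is equidistant from `x` and `y` exactly if it is in neither of the two branches that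
contain them. If no vertex on the legs of some centre is equidistant, the `k` singleton classes of
its first two legs distinguish them. If there is just one centre and only one equidistant vertex,
all colour classes are singletons, and the third leg compensates for the one that may fail. In the
remaining case `x` and `y` lie on two legs of a centre `w` at the same distance from `w`; the
colours of these two legs number at least `k`, and each of them distinguishes `x` from `y` although
it may be shared: its vertices at other centres are farther away than the one on the leg is from
the vertex `x` or `y` of that leg, because positions are counted from the centres
(`distinguishes_of_mem_leg`).
-/

namespace PartDim

/-! ### Distances in trees -/

section Geometry

variable {V : Type*} {G : SimpleGraph V}

/-- The vertices strictly closer to `a` than to `c`. If `c` and `a` are adjacent vertices of a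
tree, this is the component of `a` after the edge `ca` is deleted. -/
def side (G : SimpleGraph V) (c a : V) : Set V := {v | G.dist v a < G.dist v c}

/-- The vertices of the geodesics from `u` to `w`, the end `w` excluded. -/
def leg (G : SimpleGraph V) (u w : V) : Set V :=
  {v | v ≠ w ∧ G.dist u v + G.dist v w = G.dist u w}

theorem exists_adj_dist_add_one (hG : G.Connected) {v c : V} (h : v ≠ c) :
    ∃ a, G.Adj c a ∧ G.dist v a + 1 = G.dist v c := by
  obtain ⟨p, hp⟩ := hG.exists_walk_length_eq_dist c v
  cases p with
  | nil => exact absurd rfl h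
  | @cons _ a _ hadj q =>
    refine ⟨a, hadj, ?_⟩
    have h1 := G.dist_le q
    have h2 := hG.dist_triangle (u := c) (v := a) (w := v)
    rw [SimpleGraph.Walk.length_cons] at hp
    rw [SimpleGraph.dist_eq_one_iff_adj.2 hadj] at h2
    rw [G.dist_comm (u := v), G.dist_comm (u := v)]
    omega

theorem exists_vertex_on_geodesic (hG : G.Connected) (u w : V) {p : ℕ} (hp : p ≤ G.dist u w) :
    ∃ v, G.dist u v + G.dist v w = G.dist u w ∧ G.dist v w = p := by
  induction p with
  | zero => exact ⟨w, by simp, by simp⟩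
  | succ p ih =>
    obtain ⟨v, h1, h2⟩ := ih (by omega)
    have hne : u ≠ v := by
      rintro rfl
      omega
    obtain ⟨a, ha, h3⟩ := exists_adj_dist_add_one hG hne
    have h4 := hG.dist_triangle (u := u) (v := a) (w := w)
    have h5 := hG.dist_triangle (u := a) (v := v) (w := w)
    rw [SimpleGraph.dist_eq_one_iff_adj.2 ha.symm] at h5
    exact ⟨a, by omega, by omega⟩

theorem eq_of_adj_of_dist (hG : G.IsTree) {v c a b : V} (ha : G.Adj c a) (hb : G.Adj c b)
    (hda : G.dist v a < G.dist v c) (hdb : G.dist v b < G.dist v c) : a = b := by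
  obtain ⟨p, hp, hpl⟩ := hG.connected.exists_path_of_dist v a
  obtain ⟨q, hq, hql⟩ := hG.connected.exists_path_of_dist v b
  have ea := hG.dist_eq_dist_add_one_of_adj v ha
  have eb := hG.dist_eq_dist_add_one_of_adj v hb
  have hp' : (p.concat ha.symm).IsPath :=
    SimpleGraph.Walk.isPath_of_length_eq_dist _ (by rw [SimpleGraph.Walk.length_concat]; omega)
  have hq' : (q.concat hb.symm).IsPath :=
    SimpleGraph.Walk.isPath_of_length_eq_dist _ (by rw [SimpleGraph.Walk.length_concat]; omega)
  have h := congrArg Subtype.val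
    ((hG.isAcyclic.subsingleton_path v c).elim ⟨_, hp'⟩ ⟨_, hq'⟩)
  obtain ⟨h, -⟩ := SimpleGraph.Walk.concat_inj h
  exact h

/-- A vertex on the `a` side of the edge `ca` and a vertex on the `c` side are joined through
that edge. -/
theorem dist_of_mem_side (hG : G.IsTree) {c a v x : V} (hca : G.Adj c a) (hv : v ∈ side G c a)
    (hx : x ∉ side G c a) : G.dist v x = G.dist v c + G.dist c x := by
  have key : ∀ n x, x ∉ side G c a → G.dist c x = n → G.dist v x = G.dist v c + n := by
    intro n
    induction n with
    | zero =>
      intro x _ h0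
      rw [hG.connected.dist_eq_zero_iff] at h0
      rw [h0, add_zero]
    | succ n ih =>
      intro x hx hn
      have hcx : c ≠ x := by
        rintro rfl
        simp at hn
      obtain ⟨x', hadj, h1⟩ := exists_adj_dist_add_one hG.connected hcx
      have hx' : x' ∉ side G c a := by
        simp only [side, Set.mem_ofPred_eq, not_lt] at hx ⊢
        have e1 := hG.dist_eq_dist_add_one_of_adj x hca
        have e2 := hG.connected.dist_triangle (u := x) (v := x') (w := a)
        rw [SimpleGraph.dist_eq_one_iff_adj.2 hadj] at e2
        rw [G.dist_comm (u := c), G.dist_comm (u := c)] at h1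
        omega
      have h2 := ih x' hx' (by omega)
      rcases hG.dist_eq_dist_add_one_of_adj v hadj with h3 | h3
      · omega
      -- a vertex `x` nearer to `v` than `x'` would be the neighbour of `x'` on the way to `v`
      exfalso
      by_cases hc : x' = c
      · subst hc
        have : a = x := eq_of_adj_of_dist hG hca hadj.symm hv (by omega)
        subst this
        exact hx (by simp [side, SimpleGraph.dist_eq_one_iff_adj.2 hca.symm])
      · obtain ⟨x'', hadj'', h4⟩ := exists_adj_dist_add_one hG.connected (Ne.symm hc)
        have h5 : G.dist v x'' < G.dist v x' := by
          have e2 := hG.connected.dist_triangle (u := v) (v := c) (w := x'')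
          omega
        have : x = x'' := eq_of_adj_of_dist hG hadj.symm hadj'' (by omega) h5
        subst this
        omega
  exact key _ x hx rfl

theorem dist_side (hG : G.IsTree) {c a v : V} (hca : G.Adj c a) (hv : v ∈ side G c a) :
    G.dist v c = G.dist v a + 1 := by
  have := hG.dist_eq_dist_add_one_of_adj v hca
  simp only [side, Set.mem_ofPred_eq] at hv
  omega

theorem notMem_side_self (c a : V) : c ∉ side G c a := by simp [side]

theorem mem_side_self {c a : V} (hca : G.Adj c a) : a ∈ side G c a := by
  simp [side, SimpleGraph.dist_eq_one_iff_adj.2 hca.symm]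

/-- Two vertices in the same branch at `c` have a geodesic that avoids `c`. -/
theorem dist_lt_of_mem_side (hG : G.IsTree) {c a v x : V} (hca : G.Adj c a)
    (hv : v ∈ side G c a) (hx : x ∈ side G c a) : G.dist v x < G.dist v c + G.dist c x := by
  have h1 := dist_side hG hca hv
  have h2 := dist_side hG hca hx
  have h3 := hG.connected.dist_triangle (u := v) (v := a) (w := x)
  rw [G.dist_comm (u := a)] at h3
  rw [G.dist_comm (u := c)]
  omega

theorem side_unique (hG : G.IsTree) {c a b v : V} (ha : G.Adj c a) (hb : G.Adj c b)
    (hva : v ∈ side G c a) (hvb : v ∈ side G c b) : a = b :=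
  eq_of_adj_of_dist hG ha hb hva hvb

theorem exists_mem_side (hG : G.IsTree) {c v : V} (h : v ≠ c) :
    ∃ a, G.Adj c a ∧ v ∈ side G c a := by
  obtain ⟨a, h1, h2⟩ := exists_adj_dist_add_one hG.connected h
  exact ⟨a, h1, by simp only [side, Set.mem_ofPred_eq]; omega⟩

/-- On a geodesic of a tree a vertex is determined by its distance from one end. -/
theorem eq_of_mem_geodesic (hG : G.IsTree) {u w v v' : V}
    (h : G.dist u v + G.dist v w = G.dist u w) (h' : G.dist u v' + G.dist v' w = G.dist u w)
    (hd : G.dist v w = G.dist v' w) : v = v' := by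
  have key : ∀ n v v', G.dist u v + G.dist v w = G.dist u w →
      G.dist u v' + G.dist v' w = G.dist u w → G.dist v w = n → G.dist v' w = n → v = v' := by
    intro n
    induction n with
    | zero =>
      intro v v' _ _ h1 h2
      rw [hG.connected.dist_eq_zero_iff] at h1 h2
      rw [h1, h2]
    | succ n ih =>
      intro v v' h h' h1 h2
      have step : ∀ z, G.dist u z + G.dist z w = G.dist u w → G.dist z w = n + 1 →
          ∃ y, G.Adj y z ∧ G.dist u z < G.dist u y ∧ G.dist u y + G.dist y w = G.dist u w ∧
            G.dist y w = n := by
        intro z hz hzn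
        have hne : w ≠ z := by
          rintro rfl
          simp at hzn
        obtain ⟨y, hadj, hy⟩ := exists_adj_dist_add_one hG.connected hne
        have t1 := hG.connected.dist_triangle (u := u) (v := y) (w := w)
        have t2 := hG.connected.dist_triangle (u := u) (v := z) (w := y)
        rw [SimpleGraph.dist_eq_one_iff_adj.2 hadj] at t2
        rw [G.dist_comm (u := w), G.dist_comm (u := w)] at hy
        exact ⟨y, hadj.symm, by omega, by omega, by omega⟩
      obtain ⟨y, a1, a2, a3, a4⟩ := step v h h1
      obtain ⟨y', b1, b2, b3, b4⟩ := step v' h' h2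
      obtain rfl := ih y y' a3 b3 a4 b4
      exact eq_of_adj_of_dist hG a1 b1 a2 b2
  exact key _ v v' h h' hd rfl

/-- If two vertices have an equidistant vertex, then the midpoint `c` of their path is one, and a
vertex is equidistant iff it lies in neither of the two branches at `c` that contain them. -/
theorem exists_midpoint [Finite V] (hG : G.IsTree) {x y z : V} (hxy : x ≠ y)
    (hz : G.dist z x = G.dist z y) : ∃ c a b, G.Adj c a ∧ G.Adj c b ∧ a ≠ b ∧
      G.dist x c = G.dist y c ∧ x ∈ side G c a ∧ y ∈ side G c b ∧
      ∀ v, G.dist v x = G.dist v y ↔ v ∉ side G c a ∧ v ∉ side G c b := by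
  -- the midpoint is the equidistant vertex nearest to `x`
  obtain ⟨c, hc, hcmin⟩ := (Set.toFinite {z | G.dist z x = G.dist z y}).exists_minimalFor
    (fun v => G.dist x v) _ ⟨z, hz⟩
  simp only [Set.mem_ofPred_eq] at hc hcmin
  have hxc : x ≠ c := by
    rintro rfl
    rw [SimpleGraph.dist_self] at hc
    exact hxy (hG.connected.dist_eq_zero_iff.1 hc.symm)
  have hyc : y ≠ c := by
    rintro rfl
    rw [SimpleGraph.dist_self] at hc
    exact hxy (hG.connected.dist_eq_zero_iff.1 hc).symm
  obtain ⟨a, ha, hxa⟩ := exists_mem_side hG hxc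
  obtain ⟨b, hb, hyb⟩ := exists_mem_side hG hyc
  have hab : a ≠ b := by
    rintro rfl
    have h1 := dist_side hG ha hxa
    have h2 := dist_side hG hb hyb
    rw [G.dist_comm (u := c), G.dist_comm (u := c)] at hc
    have := hcmin (j := a) (by rw [G.dist_comm (u := a), G.dist_comm (u := a)]; omega) (by omega)
    omega
  have hya : y ∉ side G c a := fun h => hab (side_unique hG ha hb h hyb)
  have hxb : x ∉ side G c b := fun h => hab (side_unique hG ha hb hxa h)
  refine ⟨c, a, b, ha, hb, hab, by rw [G.dist_comm (u := x), hc, G.dist_comm], hxa, hyb, ?_⟩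
  intro v
  constructor
  · intro hv
    constructor <;> intro hs
    · have h1 := dist_of_mem_side hG ha hs hya
      have h2 := dist_lt_of_mem_side hG ha hs hxa
      omega
    · have h1 := dist_of_mem_side hG hb hs hxb
      have h2 := dist_lt_of_mem_side hG hb hs hyb
      omega
  · rintro ⟨h1, h2⟩
    have h3 := dist_of_mem_side hG ha hxa h1
    have h4 := dist_of_mem_side hG hb hyb h2
    rw [G.dist_comm (u := v), G.dist_comm (u := v), h3, h4]
    rw [G.dist_comm (u := c), G.dist_comm (u := c)] at hc
    omega

end Geometry

/-! ### Legs and branches -/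

section Branches

variable {V : Type*} [Fintype V] {G : SimpleGraph V} [DecidableRel G.Adj]

theorem not_isMajor_of_mem_leg {u w v : V} (hu : u ∈ terminals G w)
    (hv : v ∈ leg G u w) : ¬ IsMajor G v := by
  intro hm
  have h1 := hu.2 v hm hv.1
  have h2 := hv.2
  omega

theorem eq_or_eq_of_not_isMajor {v a b n : V} (hv : ¬ IsMajor G v) (ha : G.Adj v a)
    (hb : G.Adj v b) (hn : G.Adj v n) (hab : a ≠ b) : n = a ∨ n = b := by
  classical
  by_contra hcon
  push Not at hcon
  apply hv
  have hsub : ({n, a, b} : Finset V) ⊆ G.neighborFinset v := by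
    intro z hz
    simp only [Finset.mem_insert, Finset.mem_singleton] at hz
    rw [SimpleGraph.mem_neighborFinset]
    rcases hz with rfl | rfl | rfl <;> assumption
  have := Finset.card_le_card hsub
  rw [Finset.card_eq_three.2 ⟨n, a, b, hcon.1, hcon.2, hab, rfl⟩] at this
  exact this

theorem eq_of_degree_eq_one {v a b : V} (hv : G.degree v = 1) (ha : G.Adj v a)
    (hb : G.Adj v b) : a = b := by
  obtain ⟨z, hz⟩ := Finset.card_eq_one.1 hv
  have ha' := (G.mem_neighborFinset v a).2 ha
  have hb' := (G.mem_neighborFinset v b).2 hb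
  rw [hz, Finset.mem_singleton] at ha' hb'
  rw [ha', hb']

theorem ne_of_mem_terminals {u w : V} (hw : IsMajor G w) (hu : u ∈ terminals G w) : u ≠ w := by
  rintro rfl
  have := hu.1
  have h3 : 3 ≤ G.degree u := hw
  omega

/-- The leg of a terminal vertex is a whole branch: its vertices have degree at most two, so
nothing is attached to it. -/
theorem leg_eq_side (hG : G.IsTree) {u w a : V} (hu : u ∈ terminals G w)
    (ha : G.Adj w a) (hua : u ∈ side G w a) : leg G u w = side G w a := by
  ext v
  constructor
  · intro hv
    by_contra hns
    have h1 := dist_of_mem_side hG ha hua hns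
    have h2 := hv.2
    have h3 := hG.connected.pos_dist_of_ne hv.1
    rw [G.dist_comm (u := w)] at h1
    omega
  · intro hv
    have key : ∀ n v, v ∈ side G w a → G.dist w v = n → v ∈ leg G u w := by
      intro n
      induction n with
      | zero =>
        intro v hv h0
        rw [hG.connected.dist_eq_zero_iff] at h0
        exact absurd (h0 ▸ hv) (notMem_side_self _ _)
      | succ n ih =>
        intro v hv hn
        have hwv : w ≠ v := by
          rintro rfl
          simp at hn
        by_cases hva : v = a
        · subst hva
          refine ⟨hwv.symm, ?_⟩
          rw [dist_side hG ha hua, SimpleGraph.dist_eq_one_iff_adj.2 ha.symm]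
        obtain ⟨v', hadj, hv'⟩ := exists_adj_dist_add_one hG.connected hwv
        have hv'w : v' ≠ w := by
          rintro rfl
          exact hva (side_unique hG hadj.symm ha (mem_side_self hadj.symm) hv)
        have hv's : v' ∈ side G w a := by
          by_contra hns
          have h1 := dist_of_mem_side hG ha hv hns
          rw [SimpleGraph.dist_eq_one_iff_adj.2 hadj, G.dist_comm (u := v)] at h1
          have := hG.connected.pos_dist_of_ne hv'w.symm
          omega
        have hl := ih v' hv's (by omega)
        obtain ⟨v'', hadj'', hv''⟩ := exists_adj_dist_add_one hG.connected hv'w.symm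
        have hvv : v'' ≠ v := by
          rintro rfl
          omega
        have huv : u ≠ v' := by
          rintro rfl
          exact hvv (eq_of_degree_eq_one hu.1 hadj'' hadj.symm)
        obtain ⟨n', hn', hun⟩ := exists_adj_dist_add_one hG.connected huv
        have hl2 := hl.2
        have t1 := hG.connected.dist_triangle (u := u) (v := n') (w := w)
        have hnn : v'' ≠ n' := by
          rintro rfl
          rw [G.dist_comm (u := w), G.dist_comm (u := w)] at hv''
          omega
        rcases eq_or_eq_of_not_isMajor (not_isMajor_of_mem_leg hu hl) hadj'' hn'
          hadj.symm hnn with h | h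
        · exact absurd h.symm hvv
        · subst h
          refine ⟨hwv.symm, ?_⟩
          rw [G.dist_comm (u := w), G.dist_comm (u := w)] at hv'
          omega
    exact key _ v hv rfl

theorem exists_side_eq_leg (hG : G.IsTree) {u w : V} (hw : IsMajor G w)
    (hu : u ∈ terminals G w) : ∃ a, G.Adj w a ∧ u ∈ side G w a ∧ leg G u w = side G w a := by
  obtain ⟨a, ha, hua⟩ := exists_mem_side hG (ne_of_mem_terminals hw hu)
  exact ⟨a, ha, hua, leg_eq_side hG hu ha hua⟩

theorem dist_of_mem_leg (hG : G.IsTree) {u w v x : V} (hw : IsMajor G w)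
    (hu : u ∈ terminals G w) (hv : v ∈ leg G u w) (hx : x ∉ leg G u w) :
    G.dist v x = G.dist v w + G.dist w x := by
  obtain ⟨a, ha, -, h⟩ := exists_side_eq_leg hG hw hu
  rw [h] at hv hx
  exact dist_of_mem_side hG ha hv hx

theorem dist_lt_of_mem_leg (hG : G.IsTree) {u w v x : V} (hw : IsMajor G w)
    (hu : u ∈ terminals G w) (hv : v ∈ leg G u w) (hx : x ∈ leg G u w) :
    G.dist v x < G.dist v w + G.dist w x := by
  obtain ⟨a, ha, -, h⟩ := exists_side_eq_leg hG hw hu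
  rw [h] at hv hx
  exact dist_lt_of_mem_side hG ha hv hx

theorem eq_of_mem_leg (hG : G.IsTree) {u w u' w' v : V} (hw : IsMajor G w)
    (hu : u ∈ terminals G w) (hw' : IsMajor G w') (hu' : u' ∈ terminals G w')
    (hv : v ∈ leg G u w) (hv' : v ∈ leg G u' w') : w = w' ∧ u = u' := by
  have hww : w = w' := by
    have h1 := dist_of_mem_leg hG hw hu hv
      (fun h => not_isMajor_of_mem_leg hu h hw' : w' ∉ leg G u w)
    have h2 := dist_of_mem_leg hG hw' hu' hv'
      (fun h => not_isMajor_of_mem_leg hu' h hw : w ∉ leg G u' w')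
    exact hG.connected.dist_eq_zero_iff.1 (by omega)
  subst hww
  refine ⟨rfl, ?_⟩
  obtain ⟨a, ha, hua, h⟩ := exists_side_eq_leg hG hw hu
  obtain ⟨a', ha', hua', h'⟩ := exists_side_eq_leg hG hw hu'
  obtain rfl := side_unique hG ha ha' (h ▸ hv) (h' ▸ hv')
  have h1 : u' ∈ leg G u w := h ▸ hua'
  have h2 : u ∈ leg G u' w := h' ▸ hua
  have h3 := h1.2
  have h4 := h2.2
  rw [G.dist_comm (u := u')] at h4
  exact hG.connected.dist_eq_zero_iff.1 (by omega)

/-- A branch without major vertices at a major vertex ends in a terminal vertex: a vertex of the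
branch at greatest distance is an end vertex. -/
theorem exists_terminal_mem_side (hG : G.IsTree) {c a : V} (hca : G.Adj c a)
    (h : ∀ v ∈ side G c a, ¬ IsMajor G v) : ∃ u ∈ terminals G c, u ∈ side G c a := by
  obtain ⟨u, hus, humax⟩ := (Set.toFinite (side G c a)).exists_maximalFor (fun v => G.dist v c) _
    ⟨a, mem_side_self hca⟩
  have huc : c ≠ u := by
    rintro rfl
    exact notMem_side_self _ _ hus
  have hdeg : G.degree u = 1 := by
    obtain ⟨n, hn, hdn⟩ := exists_adj_dist_add_one hG.connected huc
    rw [SimpleGraph.degree, Finset.card_eq_one]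
    refine ⟨n, Finset.eq_singleton_iff_unique_mem.2 ⟨(G.mem_neighborFinset u n).2 hn, ?_⟩⟩
    intro b hb
    rw [SimpleGraph.mem_neighborFinset] at hb
    refine eq_of_adj_of_dist hG (v := c) hb hn ?_ (by omega)
    rcases hG.dist_eq_dist_add_one_of_adj c hb with h1 | h1
    · omega
    exfalso
    have hbs : b ∈ side G c a := by
      have h2 := dist_side hG hca hus
      have h3 := hG.connected.dist_triangle (u := b) (v := u) (w := a)
      rw [SimpleGraph.dist_eq_one_iff_adj.2 hb.symm] at h3
      simp only [side, Set.mem_ofPred_eq]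
      rw [G.dist_comm (u := c), G.dist_comm (u := c)] at h1
      omega
    have h4 := humax hbs
    rw [G.dist_comm (u := c), G.dist_comm (u := c)] at h1
    simp only at h4
    omega
  refine ⟨u, ⟨hdeg, fun w' hw' hne => ?_⟩, hus⟩
  have h1 := dist_of_mem_side hG hca hus (fun hh => h w' hh hw')
  have := hG.connected.pos_dist_of_ne hne.symm
  omega

/-- Branches without major vertices give pairwise different terminal vertices. -/
theorem card_le_ter (hG : G.IsTree) {w : V} {s : Finset V}
    (hs : ∀ b ∈ s, G.Adj w b ∧ ∀ v ∈ side G w b, ¬ IsMajor G v) : s.card ≤ ter G w := by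
  classical
  have hex : ∀ b : V, ∃ u, b ∈ s → u ∈ terminals G w ∧ u ∈ side G w b := by
    intro b
    by_cases hb : b ∈ s
    · obtain ⟨u, h1, h2⟩ := exists_terminal_mem_side hG (hs b hb).1 (hs b hb).2
      exact ⟨u, fun _ => ⟨h1, h2⟩⟩
    · exact ⟨b, fun h => absurd h hb⟩
  choose f hf using hex
  rw [ter, ← Set.ncard_coe_finset s]
  refine Set.ncard_le_ncard_of_injOn f (fun b hb => (hf b hb).1) ?_ (Set.toFinite _)
  intro b hb b' hb' h
  exact side_unique hG (hs b hb).1 (hs b' hb').1 (hf b hb).2 (h ▸ (hf b' hb').2)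

/-- A branch with a major vertex contains an exterior major vertex of terminal degree at least
two, namely its major vertex farthest from the root of the branch. -/
theorem exists_extMajor_mem_side (hG : G.IsTree) {c a v : V} (hca : G.Adj c a)
    (hv : v ∈ side G c a) (hmv : IsMajor G v) : ∃ w ∈ extMajor G, w ∈ side G c a := by
  classical
  obtain ⟨w, ⟨hws, hwm⟩, hwmax⟩ :=
    (Set.toFinite {v | v ∈ side G c a ∧ IsMajor G v}).exists_maximalFor
      (fun v => G.dist v c) _ ⟨v, hv, hmv⟩
  refine ⟨w, ⟨hwm, ?_⟩, hws⟩
  have hcw : c ≠ w := by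
    rintro rfl
    exact notMem_side_self _ _ hws
  obtain ⟨n, hn, hdn⟩ := exists_adj_dist_add_one hG.connected hcw
  have hcard : 2 ≤ ((G.neighborFinset w).erase n).card := by
    rw [Finset.card_erase_of_mem ((G.mem_neighborFinset w n).2 hn)]
    have : 3 ≤ (G.neighborFinset w).card := hwm
    omega
  refine lt_of_lt_of_le (by omega) (hcard.trans (card_le_ter hG ?_))
  intro b hb
  rw [Finset.mem_erase, SimpleGraph.mem_neighborFinset] at hb
  refine ⟨hb.2, fun z hz hzm => ?_⟩
  have hdb : G.dist c b = G.dist c w + 1 := by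
    rcases hG.dist_eq_dist_add_one_of_adj c hb.2 with h1 | h1
    · exact absurd (eq_of_adj_of_dist hG (v := c) hb.2 hn (by omega) (by omega)) hb.1
    · exact h1
  have hwa := dist_side hG hca hws
  have hcn : c ∉ side G w b := by
    simp only [side, Set.mem_ofPred_eq]
    omega
  have han : a ∉ side G w b := by
    simp only [side, Set.mem_ofPred_eq]
    have t := hG.connected.dist_triangle (u := c) (v := a) (w := b)
    rw [SimpleGraph.dist_eq_one_iff_adj.2 hca] at t
    rw [G.dist_comm (u := w), G.dist_comm (u := w)] at hwa
    omega
  have h1 := dist_of_mem_side hG hb.2 hz hcn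
  have h2 := dist_of_mem_side hG hb.2 hz han
  have hzs : z ∈ side G c a := by
    simp only [side, Set.mem_ofPred_eq]
    omega
  have h3 := hwmax ⟨hzs, hzm⟩
  have h4 : z ≠ w := by
    rintro rfl
    exact notMem_side_self _ _ hz
  have := hG.connected.pos_dist_of_ne h4
  simp only at h3
  omega

/-- If there is only one exterior major vertex of terminal degree at least two, then every branch
at it is a leg. -/
theorem three_le_ter_of_extMajor_eq_singleton (hG : G.IsTree) {w : V} (h : extMajor G = {w}) :
    3 ≤ ter G w := by
  have hw : w ∈ extMajor G := by rw [h]; rfl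
  refine le_trans (hw.1 : 3 ≤ (G.neighborFinset w).card) (card_le_ter hG fun b hb => ?_)
  rw [SimpleGraph.mem_neighborFinset] at hb
  refine ⟨hb, fun v hv hm => ?_⟩
  obtain ⟨w', h1, h2⟩ := exists_extMajor_mem_side hG hb hv hm
  rw [h, Set.mem_singleton_iff] at h1
  exact notMem_side_self _ _ (h1 ▸ h2)

/-! ### Separating two vertices -/

/-- The alternatives when an exterior major vertex lies in the branch of `x` at the midpoint. -/
theorem separation_of_extMajor_mem_side (hG : G.IsTree) {x y c a b w : V} (ha : G.Adj c a)
    (hb : G.Adj c b) (hab : a ≠ b)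
    (heq : ∀ v, G.dist v x = G.dist v y ↔ v ∉ side G c a ∧ v ∉ side G c b)
    (hw : w ∈ extMajor G) (hwa : w ∈ side G c a) :
    (∃ w ∈ extMajor G, ∀ u ∈ terminals G w, ∀ z ∈ leg G u w, G.dist z x ≠ G.dist z y) ∨
    (∃ w c, extMajor G = {w} ∧ ∀ z, z ≠ c → G.dist z x ≠ G.dist z y) := by
  by_cases hall : ∀ u ∈ terminals G w, ∀ z ∈ leg G u w, G.dist z x ≠ G.dist z y
  · exact Or.inl ⟨w, hw, hall⟩
  push Not at hall
  obtain ⟨u, hu, z, hz, hzeq⟩ := hall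
  have hzs := (heq z).1 hzeq
  -- the midpoint lies between `z` and `w`, hence on the leg, and has no third branch
  have hcleg : c ∈ leg G u w := by
    have h1 := dist_of_mem_side hG ha hwa hzs.1
    have h2 := hz.2
    have t1 := hG.connected.dist_triangle (u := u) (v := z) (w := c)
    have t2 := hG.connected.dist_triangle (u := u) (v := c) (w := w)
    refine ⟨fun h => notMem_side_self _ _ (h ▸ hwa), ?_⟩
    rw [G.dist_comm (u := w), G.dist_comm (u := w), G.dist_comm (u := c) (v := z)] at h1
    omega
  have hcm := not_isMajor_of_mem_leg hu hcleg
  have hne : ∀ v, v ≠ c → G.dist v x ≠ G.dist v y := by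
    intro v hvc hv
    obtain ⟨n, hn, hvn⟩ := exists_mem_side hG hvc
    have := (heq v).1 hv
    rcases eq_or_eq_of_not_isMajor hcm ha hb hn hab with rfl | rfl
    · exact this.1 hvn
    · exact this.2 hvn
  by_cases hM : ∃ w' ∈ extMajor G, w' ≠ w
  · obtain ⟨w', hw', hww⟩ := hM
    refine Or.inl ⟨w', hw', fun u' hu' z' hz' => hne z' ?_⟩
    rintro rfl
    exact hww (eq_of_mem_leg hG hw'.1 hu' hw.1 hu hz' hcleg).1
  · push Not at hM
    exact Or.inr ⟨w, c, Set.eq_singleton_iff_unique_mem.2 ⟨hw, hM⟩, hne⟩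

/-- How two different vertices `x`, `y` are separated: either no vertex of the legs of some
exterior major vertex is equidistant from them; or the tree has a single exterior major vertex
and at most one equidistant vertex; or they are at the same distance from an exterior major
vertex, on two of its legs. -/
theorem separation (hG : G.IsTree) (hM : (extMajor G).Nonempty) {x y : V} (hxy : x ≠ y) :
    (∃ w ∈ extMajor G, ∀ u ∈ terminals G w, ∀ z ∈ leg G u w, G.dist z x ≠ G.dist z y) ∨
    (∃ w c, extMajor G = {w} ∧ ∀ z, z ≠ c → G.dist z x ≠ G.dist z y) ∨
    (∃ w ∈ extMajor G, ∃ u ∈ terminals G w, ∃ u' ∈ terminals G w, u ≠ u' ∧ x ∈ leg G u w ∧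
      y ∈ leg G u' w ∧ G.dist x w = G.dist y w) := by
  classical
  obtain ⟨w₀, hw₀⟩ := hM
  by_cases hex : ∃ z, G.dist z x = G.dist z y
  swap
  · push Not at hex
    exact Or.inl ⟨w₀, hw₀, fun u _ z _ => hex z⟩
  obtain ⟨z, hz⟩ := hex
  obtain ⟨c, a, b, ha, hb, hab, hd, hxa, hyb, heq⟩ := exists_midpoint hG hxy hz
  by_cases hma : ∃ v ∈ side G c a, IsMajor G v
  · obtain ⟨v, hv, hvm⟩ := hma
    obtain ⟨w, hw, hws⟩ := exists_extMajor_mem_side hG ha hv hvm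
    rcases separation_of_extMajor_mem_side hG ha hb hab heq hw hws with h | h
    · exact Or.inl h
    · exact Or.inr (Or.inl h)
  by_cases hmb : ∃ v ∈ side G c b, IsMajor G v
  · obtain ⟨v, hv, hvm⟩ := hmb
    obtain ⟨w, hw, hws⟩ := exists_extMajor_mem_side hG hb hv hvm
    rcases separation_of_extMajor_mem_side hG (x := y) (y := x) hb ha hab.symm
      (fun v => by rw [eq_comm, heq v, and_comm]) hw hws with h | h
    · simp only [ne_comm (a := G.dist _ y)] at h
      exact Or.inl h
    · simp only [ne_comm (a := G.dist _ y)] at h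
      exact Or.inr (Or.inl h)
  push Not at hma hmb
  have hcm : IsMajor G c := by
    by_contra hcm
    by_cases hwc : w₀ = c
    · exact hcm (hwc ▸ hw₀.1)
    obtain ⟨n, hn, hvn⟩ := exists_mem_side hG hwc
    rcases eq_or_eq_of_not_isMajor hcm ha hb hn hab with rfl | rfl
    · exact hma _ hvn hw₀.1
    · exact hmb _ hvn hw₀.1
  obtain ⟨u, hu, hus⟩ := exists_terminal_mem_side hG ha hma
  obtain ⟨u', hu', hus'⟩ := exists_terminal_mem_side hG hb hmb
  have htwo : 2 ≤ ter G c := by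
    rw [← Finset.card_pair hab]
    refine card_le_ter hG fun n hn => ?_
    rw [Finset.mem_insert, Finset.mem_singleton] at hn
    rcases hn with rfl | rfl
    · exact ⟨ha, hma⟩
    · exact ⟨hb, hmb⟩
  refine Or.inr (Or.inr ⟨c, ⟨hcm, htwo⟩, u, hu, u', hu', ?_, ?_, ?_, hd⟩)
  · rintro rfl
    exact hab (side_unique hG ha hb hus hus')
  · rw [leg_eq_side hG hu ha hus]
    exact hxa
  · rw [leg_eq_side hG hu' hb hus']
    exact hyb

end Branches


/-! ### The shared colours -/

section Levels

variable {V : Type*} [Fintype V] {G : SimpleGraph V} [DecidableRel G.Adj]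

theorem legLengths_finite : (legLengths G).Finite := (Set.toFinite _).image _

theorem exists_level_eq {w : V} (hw : w ∈ extMajor G) : ∃ i, 1 ≤ i ∧ i ≤ numLevels G ∧
    level G i = legLen G w ∧ ter G w ≤ levelTer G i := by
  have hmem : legLen G w ∈ legLengths G := ⟨w, hw, rfl⟩
  obtain ⟨n, hn, hnth⟩ := Nat.exists_lt_card_finite_nth_eq
    (p := fun n => n ∈ legLengths G) legLengths_finite hmem
  have hcard : numLevels G = (legLengths_finite (G := G)).toFinset.card :=
    Set.ncard_eq_toFinset_card _ _
  have hl : level G (n + 1) = legLen G w := hnth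
  refine ⟨n + 1, by omega, ?_, hl, ?_⟩
  · rw [hcard]
    exact hn
  · exact le_csSup ((Set.toFinite _).image _).bddAbove ⟨w, ⟨hw, hl.symm⟩, rfl⟩

theorem level_le_level {i j : ℕ} (hij : i ≤ j) (hj : 1 ≤ j) (hjr : j ≤ numLevels G) :
    level G i ≤ level G j := by
  have hcard : numLevels G = (legLengths_finite (G := G)).toFinset.card :=
    Set.ncard_eq_toFinset_card _ _
  refine Nat.nth_le_nth' (by omega) fun hf => ?_
  rw [hcard] at hjr
  have : hf.toFinset.card = (legLengths_finite (G := G)).toFinset.card := rfl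
  omega

theorem level_le_of_le_cutIndex {k i : ℕ} (hi : 2 ≤ i) (his : i ≤ cutIndex G k) :
    i ≤ numLevels G ∧ level G i ≤ k / 2 := by
  unfold cutIndex at his
  split_ifs at his with h
  swap
  · omega
  set S := {i | 1 ≤ i ∧ i ≤ numLevels G ∧ level G i ≤ k / 2}
  have hne : S.Nonempty := by
    by_contra hS
    rw [Set.not_nonempty_iff_eq_empty] at hS
    rw [hS] at his
    simp at his
    omega
  have hbdd : BddAbove S := ⟨numLevels G, fun i hi => hi.2.1⟩
  obtain ⟨h1, h2, h3⟩ := Nat.sSup_mem hne hbdd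
  exact ⟨his.trans h2, (level_le_level his h1 h2).trans h3⟩

theorem one_le_cutIndex {k i : ℕ} (hi : 1 ≤ i) (hir : i ≤ numLevels G) : 1 ≤ cutIndex G k := by
  unfold cutIndex
  split_ifs with h
  · exact le_csSup ⟨numLevels G, fun i hi => hi.2.1⟩ ⟨le_rfl, hi.trans hir, h⟩
  · exact le_rfl

theorem lt_level_of_cutIndex_lt {k i : ℕ} (hir : i ≤ numLevels G) (hi : 1 ≤ i)
    (his : cutIndex G k < i) : k / 2 < level G i := by
  unfold cutIndex at his
  split_ifs at his with h
  · by_contra hcon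
    push Not at hcon
    have := le_csSup (s := {i | 1 ≤ i ∧ i ≤ numLevels G ∧ level G i ≤ k / 2})
      ⟨numLevels G, fun i hi => hi.2.1⟩ ⟨hi, hir, hcon⟩
    omega
  · have := level_le_level (G := G) (i := 1) hi hi hir
    omega

variable (G) in
/-- The pairs (leg index, position) for which a shared colour is needed. Leg indices start at
`0`, and a leg index `i` first occurs at the first level whose terminal degree exceeds `i`; by
monotonicity of the levels this level needs the most positions. -/
noncomputable def sharedPairs (k : ℕ) : Finset (ℕ × ℕ) :=
  (Finset.Ico 2 (levelTer G 1) ×ˢ Finset.Icc 1 (max (k - level G 1) ((k + 1) / 2))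
    ∪ (Finset.Icc 2 (cutIndex G k)).biUnion (fun i =>
      Finset.Ico ((Finset.Ico 1 i).sup (levelTer G)) (levelTer G i) ×ˢ
        Finset.Icc 1 (k - level G i)))
    ∪ Finset.Ico ((Finset.Icc 1 (cutIndex G k)).sup (levelTer G))
        ((Finset.Ioc (cutIndex G k) (numLevels G)).sup (levelTer G)) ×ˢ
      Finset.Icc 1 ((k + 1) / 2)

theorem card_sharedPairs_le (k : ℕ) : (sharedPairs G k).card ≤ bigI G k := by
  unfold sharedPairs bigI
  refine (Finset.card_union_le _ _).trans (Nat.add_le_add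
    ((Finset.card_union_le _ _).trans (Nat.add_le_add ?_ (Finset.card_biUnion_le.trans ?_))) ?_)
  · simp
  · exact Finset.sum_le_sum fun i _ => by simp
  · simp

theorem mem_sharedPairs {k i p : ℕ} {w : V} (hw : w ∈ extMajor G) (hi : 2 ≤ i)
    (hit : i < ter G w) (hp : 1 ≤ p) (hpq : p ≤ max (k - legLen G w) ((k + 1) / 2)) :
    (i, p) ∈ sharedPairs G k := by
  classical
  obtain ⟨n, hn1, hnr, hnl, hnt⟩ := exists_level_eq hw
  have hex : ∃ j, 1 ≤ j ∧ i < levelTer G j := ⟨n, hn1, by omega⟩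
  set j := Nat.find hex
  obtain ⟨hj1, hj⟩ := Nat.find_spec hex
  have hjn : j ≤ n := Nat.find_min' hex ⟨hn1, by omega⟩
  have hjmin : ∀ m, 1 ≤ m → m < j → levelTer G m ≤ i := by
    intro m hm hmj
    by_contra hcon
    exact Nat.find_min hex hmj ⟨hm, by omega⟩
  have hlev : level G j ≤ legLen G w := hnl ▸ level_le_level hjn hn1 hnr
  have hcut := one_le_cutIndex (G := G) (k := k) hn1 hnr
  simp only [sharedPairs, Finset.mem_union, Finset.mem_product, Finset.mem_biUnion,
    Finset.mem_Ico, Finset.mem_Icc]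
  by_cases hj_one : j = 1
  · have h1 : level G 1 ≤ legLen G w := hj_one ▸ hlev
    have h2 : i < levelTer G 1 := hj_one ▸ hj
    exact Or.inl (Or.inl ⟨⟨hi, h2⟩, hp, by omega⟩)
  have hj2 : 2 ≤ j := by
    have : 1 ≤ j := hj1
    omega
  by_cases hjs : j ≤ cutIndex G k
  · have h1 := level_le_of_le_cutIndex hj2 hjs
    refine Or.inl (Or.inr ⟨j, ⟨hj2, hjs⟩, ⟨Finset.sup_le fun m hm => ?_, hj⟩, hp, by omega⟩)
    rw [Finset.mem_Ico] at hm
    exact hjmin m hm.1 hm.2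
  · push Not at hjs
    have h1 := lt_level_of_cutIndex_lt (hjn.trans hnr) hj1 hjs
    refine Or.inr ⟨⟨Finset.sup_le fun m hm => ?_, ?_⟩, hp, by omega⟩
    · rw [Finset.mem_Icc] at hm
      exact hjmin m hm.1 (by omega)
    · exact lt_of_lt_of_le hj (Finset.le_sup (f := levelTer G)
        (Finset.mem_Ioc.2 ⟨hjs, hjn.trans hnr⟩))

end Levels

/-! ### Leg lengths and quotas -/

section Quota

variable {V : Type*} [Fintype V] {G : SimpleGraph V} [DecidableRel G.Adj]

variable (G) in
/-- The number of coloured vertices on the leg with index `i` at `w`, where index `0` belongs to a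
shortest leg. -/
noncomputable def quota (k : ℕ) (w : V) (i : ℕ) : ℕ :=
  if i = 0 then min (legLen G w) (k / 2) else max (k - legLen G w) ((k + 1) / 2)

theorem quota_zero_add_quota_one (k : ℕ) (w : V) : quota G k w 0 + quota G k w 1 = k := by
  simp only [quota, if_true, one_ne_zero, if_false]
  omega

theorem le_quota_add_quota (k : ℕ) (w : V) {i j : ℕ} (hij : i ≠ j) :
    k ≤ quota G k w i + quota G k w j := by
  unfold quota
  split_ifs <;> omega

theorem legLen_le {u w : V} (hu : u ∈ terminals G w) : legLen G w ≤ G.dist u w :=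
  Nat.sInf_le ⟨u, hu, rfl⟩

theorem sigma_le {u v w : V} (hw : w ∈ extMajor G) (hu : u ∈ terminals G w)
    (hv : v ∈ terminals G w) (huv : u ≠ v) : sigma G ≤ G.dist u w + G.dist v w := by
  refine (Nat.sInf_le ⟨w, hw, rfl⟩ : sigma G ≤ sigmaAt G w).trans
    (Nat.sInf_le ⟨u, hu, v, hv, huv, ?_⟩)
  rw [G.dist_comm (u := v)]

theorem extMajor_nonempty (h : 1 ≤ sigma G) : (extMajor G).Nonempty := by
  by_contra hM
  rw [Set.not_nonempty_iff_eq_empty] at hM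
  rw [sigma, hM, Set.image_empty, Nat.sInf_empty] at h
  omega

variable (G) in
/-- `g w` numbers the terminal vertices of `w` by `0, …, ter w - 1`, beginning with one at least
distance from `w`. -/
def IsLegNumbering (g : V → V → ℕ) : Prop :=
  ∀ w ∈ extMajor G, Set.BijOn (g w) (terminals G w) (Set.Iio (ter G w)) ∧
    ∀ u ∈ terminals G w, g w u = 0 → G.dist u w = legLen G w

theorem exists_isLegNumbering : ∃ g, IsLegNumbering G g := by
  classical
  have key : ∀ w, ∃ f : V → ℕ, w ∈ extMajor G →
      Set.BijOn f (terminals G w) (Set.Iio (ter G w)) ∧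
        ∀ u ∈ terminals G w, f u = 0 → G.dist u w = legLen G w := by
    intro w
    by_cases hw : w ∈ extMajor G
    swap
    · exact ⟨fun _ => 0, fun h => absurd h hw⟩
    have hpos : 0 < ter G w := lt_trans one_pos hw.2
    have hne : (terminals G w).Nonempty := Set.nonempty_of_ncard_ne_zero hpos.ne'
    obtain ⟨u₀, hu₀, hl⟩ := Nat.sInf_mem (hne.image fun z => G.dist z w)
    have hcard : (terminals G w).encard = (Set.Iio (ter G w)).encard := by
      rw [← Finset.coe_Iio, Set.encard_coe_eq_coe_finsetCard, Nat.card_Iio, ter,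
        (Set.toFinite _).cast_ncard_eq]
    obtain ⟨e, he⟩ := (Set.toFinite (terminals G w)).exists_bijOn_of_encard_eq hcard
    refine ⟨fun u => Equiv.swap 0 (e u₀) (e u), fun _ => ⟨?_, fun u hu h0 => ?_⟩⟩
    · exact (Equiv.swap_bijOn_self ⟨fun _ => he.mapsTo hu₀, fun _ => hpos⟩).comp he
    · have h1 : e u = e u₀ := by
        rw [Equiv.swap_apply_eq_iff, Equiv.swap_apply_left] at h0
        exact h0
      rw [he.injOn hu hu₀ h1]
      exact hl
  choose g hg using key
  exact ⟨g, fun w hw => hg w hw⟩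

theorem quota_le_dist {k : ℕ} {g : V → V → ℕ} (hg : IsLegNumbering G g) (hk : k ≤ sigma G)
    {u w : V} (hw : w ∈ extMajor G) (hu : u ∈ terminals G w) :
    quota G k w (g w u) ≤ G.dist u w := by
  obtain ⟨hbij, hzero⟩ := hg w hw
  have h1 := legLen_le hu
  unfold quota
  split_ifs with h
  · omega
  · obtain ⟨u₀, hu₀, h0⟩ := hbij.surjOn (lt_trans one_pos hw.2 : 0 < ter G w)
    have hne : u ≠ u₀ := by
      rintro rfl
      exact h h0
    have h2 := sigma_le hw hu hu₀ hne
    have h3 := hzero u₀ hu₀ h0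
    omega

end Quota


/-! ### Criteria for a set to distinguish two vertices -/

section Distinguishing

variable {V : Type*} {G : SimpleGraph V}

/-- A vertex set distinguishes `x` and `y` if some element of it is closer to `y` than all of its
elements are to `x`. -/
theorem distinguishes_of_forall_lt {S : Set V} {x y z : V} (hz : z ∈ S)
    (h : ∀ z' ∈ S, G.dist y z < G.dist x z') : Distinguishes G S x y := by
  obtain ⟨z', hz', heq⟩ := Nat.sInf_mem (s := (fun v => G.dist x v) '' S) ⟨_, z, hz, rfl⟩
  have h1 : setDist G y S ≤ G.dist y z := Nat.sInf_le ⟨z, hz, rfl⟩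
  have h2 : G.dist x z' = setDist G x S := heq
  have := h z' hz'
  unfold Distinguishes
  omega

theorem Distinguishes.symm {S : Set V} {x y : V} (h : Distinguishes G S x y) :
    Distinguishes G S y x := Ne.symm h

theorem distinguishes_of_unique {S : Set V} {x y z : V} (hz : z ∈ S)
    (huniq : ∀ z' ∈ S, z' = z) (h : G.dist z x ≠ G.dist z y) : Distinguishes G S x y := by
  rw [G.dist_comm, G.dist_comm (u := z)] at h
  rcases lt_or_gt_of_ne h with h | h
  · exact (distinguishes_of_forall_lt hz fun z' hz' => by rwa [huniq z' hz']).symm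
  · exact distinguishes_of_forall_lt hz fun z' hz' => by rwa [huniq z' hz']

end Distinguishing

/-! ### The colouring and its fibres -/

section Colouring

variable {V : Type*} [Fintype V] {G : SimpleGraph V} [DecidableRel G.Adj] {k : ℕ} {g : V → V → ℕ}

/-- The colours on the legs with indices `0` and `1` carry the name of the exterior major vertex;
those on the other legs do not, so that they are shared by all exterior major vertices. -/
def legTag {V : Type*} (w : V) (i : ℕ) : Option V := if i < 2 then some w else none

variable (G k g) in
/-- `HasColour G k g v c`: the vertex `v` is among the first `quota` vertices, counted from `w`,
of a leg at some `w ∈ extMajor G`, and `c` consists of the tag, the index of that leg and the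
position of `v` on it. -/
def HasColour (v : V) (c : Option V × ℕ × ℕ) : Prop :=
  ∃ w ∈ extMajor G, ∃ u ∈ terminals G w, v ∈ leg G u w ∧
    G.dist v w ≤ quota G k w (g w u) ∧ c = (legTag w (g w u), g w u, G.dist v w)

theorem HasColour.unique (hG : G.IsTree) {v : V} {c c' : Option V × ℕ × ℕ}
    (h : HasColour G k g v c) (h' : HasColour G k g v c') : c = c' := by
  obtain ⟨w, hw, u, hu, hv, -, rfl⟩ := h
  obtain ⟨w', hw', u', hu', hv', -, rfl⟩ := h'
  obtain ⟨rfl, rfl⟩ := eq_of_mem_leg hG hw.1 hu hw'.1 hu' hv hv'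
  rfl

variable (G k g) in
open Classical in
/-- The colouring whose fibres are the classes of the partition; the colour `none` is given to
all the remaining vertices. -/
noncomputable def colour (v : V) : Option (Option V × ℕ × ℕ) :=
  if h : ∃ c, HasColour G k g v c then some h.choose else none

theorem colour_eq_some_iff (hG : G.IsTree) {v : V} {c : Option V × ℕ × ℕ} :
    colour G k g v = some c ↔ HasColour G k g v c := by
  unfold colour
  split_ifs with h
  · rw [Option.some_inj]
    exact ⟨fun hc => hc ▸ h.choose_spec, fun hc => h.choose_spec.unique hG hc⟩
  · simp only [false_iff]
    exact fun hc => h ⟨c, hc⟩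

variable (G k) in
/-- The colours on the leg with index `i` at `w`. -/
noncomputable def legColours (w : V) (i : ℕ) : Finset (Option V × ℕ × ℕ) :=
  {legTag w i} ×ˢ {i} ×ˢ Finset.Icc 1 (quota G k w i)

theorem mem_legColours {w : V} {i : ℕ} {c : Option V × ℕ × ℕ} :
    c ∈ legColours G k w i ↔ ∃ p, 1 ≤ p ∧ p ≤ quota G k w i ∧ c = (legTag w i, i, p) := by
  obtain ⟨t, j, p⟩ := c
  simp only [legColours, Finset.mem_product, Finset.mem_singleton, Finset.mem_Icc, Prod.mk.injEq]
  constructor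
  · rintro ⟨rfl, rfl, h1, h2⟩
    exact ⟨p, h1, h2, rfl, rfl, rfl⟩
  · rintro ⟨p, h1, h2, rfl, rfl, rfl⟩
    exact ⟨rfl, rfl, h1, h2⟩

theorem card_legColours (w : V) (i : ℕ) : (legColours G k w i).card = quota G k w i := by
  simp [legColours]

theorem disjoint_legColours (w : V) {i j : ℕ} (hij : i ≠ j) :
    Disjoint (legColours G k w i) (legColours G k w j) := by
  rw [Finset.disjoint_left]
  intro c hc hc'
  obtain ⟨p, -, -, rfl⟩ := mem_legColours.1 hc
  obtain ⟨q, -, -, h⟩ := mem_legColours.1 hc'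
  simp only [Prod.mk.injEq] at h
  exact hij h.2.1

/-- The hypothesis `k ≤ sigma G` makes every leg long enough for its colours. -/
theorem exists_mem_leg_colour (hG : G.IsTree) (hg : IsLegNumbering G g) (hk : k ≤ sigma G)
    {u w : V} (hw : w ∈ extMajor G) (hu : u ∈ terminals G w) {c : Option V × ℕ × ℕ}
    (hc : c ∈ legColours G k w (g w u)) :
    ∃ v ∈ leg G u w, colour G k g v = some c ∧ c = (legTag w (g w u), g w u, G.dist v w) := by
  obtain ⟨p, hp1, hp, rfl⟩ := mem_legColours.1 hc
  obtain ⟨v, hv, rfl⟩ := exists_vertex_on_geodesic hG.connected u w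
    (hp.trans (quota_le_dist hg hk hw hu))
  have hvl : v ∈ leg G u w := by
    refine ⟨?_, hv⟩
    rintro rfl
    simp at hp1
  exact ⟨v, hvl, (colour_eq_some_iff hG).2 ⟨w, hw, u, hu, hvl, hp, rfl⟩, rfl⟩

/-- The other vertices with the colour of `v` are at the same position on legs at other exterior
major vertices. -/
theorem eq_or_of_colour_eq (hG : G.IsTree) (hg : IsLegNumbering G g) {u w v v' : V}
    (hw : w ∈ extMajor G) (hu : u ∈ terminals G w) (hv : v ∈ leg G u w)
    (h : colour G k g v' = some (legTag w (g w u), g w u, G.dist v w)) :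
    v' = v ∨ (2 ≤ g w u ∧ ∃ w' ∈ extMajor G, w' ≠ w ∧ ∃ u' ∈ terminals G w', v' ∈ leg G u' w' ∧
      G.dist v' w' = G.dist v w) := by
  obtain ⟨w', hw', u', hu', hv', -, heq⟩ := (colour_eq_some_iff hG).1 h
  simp only [Prod.mk.injEq] at heq
  obtain ⟨h1, h2, h3⟩ := heq
  by_cases hww : w' = w
  · subst hww
    obtain rfl := (hg w' hw).1.injOn hu hu' h2
    exact Or.inl (eq_of_mem_geodesic hG hv'.2 hv.2 h3.symm)
  · refine Or.inr ⟨?_, w', hw', hww, u', hu', hv', h3.symm⟩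
    by_contra hlt
    rw [← h2, legTag, legTag, if_pos (by omega), if_pos (by omega), Option.some_inj] at h1
    exact hww h1.symm

/-- Let `x` and `y` lie on two legs at `w`, at the same distance from `w`. The colours of the leg
of `y` distinguish them: the vertex of such a colour on that leg is nearer to `y` than to `x`, and
the others are farther away, because the same position on a leg at another exterior major vertex
is reached only through `w`. -/
theorem distinguishes_of_mem_leg (hG : G.IsTree) (hg : IsLegNumbering G g) {u u' w x y z : V}
    (hw : w ∈ extMajor G) (hu : u ∈ terminals G w) (hu' : u' ∈ terminals G w) (huu : u ≠ u')
    (hx : x ∈ leg G u w) (hy : y ∈ leg G u' w) (hd : G.dist x w = G.dist y w)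
    (hz : z ∈ leg G u' w) {c : Option V × ℕ × ℕ} (hc : colour G k g z = some c)
    (hcz : c = (legTag w (g w u'), g w u', G.dist z w)) :
    Distinguishes G {v | colour G k g v = some c} x y := by
  refine distinguishes_of_forall_lt hc fun z' hz' => ?_
  subst hcz
  have h1 := dist_lt_of_mem_leg hG hw.1 hu' hy hz
  have hnot : z' ∉ leg G u w := by
    intro hmem
    rcases eq_or_of_colour_eq hG hg hw hu' hz hz' with rfl | ⟨-, w', hw', hww, v, hv, hz'l, -⟩
    · exact huu (eq_of_mem_leg hG hw.1 hu hw.1 hu' hmem hz).2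
    · exact hww (eq_of_mem_leg hG hw'.1 hv hw.1 hu hz'l hmem).1
  have h2 := dist_of_mem_leg hG hw.1 hu hx hnot
  rw [G.dist_comm (u := w)] at h1 h2
  rcases eq_or_of_colour_eq hG hg hw hu' hz hz' with rfl | ⟨-, w', hw', hww, v, hv, hz'l, h3⟩
  · omega
  · have h4 := dist_of_mem_leg hG hw'.1 hv hz'l
      (fun h => not_isMajor_of_mem_leg hv h hw.1 : w ∉ leg G v w')
    omega

variable (G k g) in
/-- The partition of the vertex set into the fibres of the colouring. -/
noncomputable def colourClasses : Set (Set V) := (Setoid.ker (colour G k g)).classes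

/-- Different colours have different fibres, so it is enough to count colours. -/
theorem card_le_encard_distinguishing {x y : V} (F : Finset (Option V × ℕ × ℕ))
    (hF : ∀ c ∈ F, (∃ v, colour G k g v = some c) ∧
      Distinguishes G {v | colour G k g v = some c} x y) :
    (F.card : ℕ∞) ≤ {S ∈ colourClasses G k g | Distinguishes G S x y}.encard := by
  rw [← Set.encard_coe_eq_coe_finsetCard]
  refine Set.encard_le_encard_of_injOn (f := fun c => {v | colour G k g v = some c}) ?_ ?_
  · intro c hc
    obtain ⟨⟨v, hv⟩, hd⟩ := hF c hc
    refine ⟨⟨v, ?_⟩, hd⟩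
    ext v'
    simp only [Set.mem_ofPred_eq, Setoid.ker_def, hv]
  · intro c hc c' _ heq
    obtain ⟨⟨v, hv⟩, -⟩ := hF c hc
    have h2 : v ∈ {v | colour G k g v = some c'} := by
      rw [← show _ = {v | colour G k g v = some c'} from heq]
      exact hv
    rw [Set.mem_ofPred_eq, hv, Option.some_inj] at h2
    exact h2

theorem le_encard_distinguishing (hG : G.IsTree) (hg : IsLegNumbering G g) (hk : k ≤ sigma G)
    (hM : (extMajor G).Nonempty) {x y : V} (hxy : x ≠ y) :
    (k : ℕ∞) ≤ {S ∈ colourClasses G k g | Distinguishes G S x y}.encard := by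
  classical
  rcases separation hG hM hxy with ⟨w, hw, hall⟩ | ⟨w, z₀, hMw, hne⟩ |
    ⟨w, hw, u, hu, u', hu', huu, hx, hy, hd⟩
  · -- all colours of the legs with indices `0` and `1` at `w`
    have hcard : (legColours G k w 0 ∪ legColours G k w 1).card = k := by
      rw [Finset.card_union_of_disjoint (disjoint_legColours w zero_ne_one), card_legColours,
        card_legColours, quota_zero_add_quota_one]
    refine (Nat.cast_le.2 hcard.ge).trans (card_le_encard_distinguishing _ fun c hc => ?_)
    have hi : ∃ i < 2, c ∈ legColours G k w i := by
      rcases Finset.mem_union.1 hc with h | h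
      · exact ⟨0, two_pos, h⟩
      · exact ⟨1, one_lt_two, h⟩
    obtain ⟨i, hi2, hi⟩ := hi
    obtain ⟨u, hu, rfl⟩ := (hg w hw).1.surjOn (lt_of_lt_of_le hi2 hw.2 : i < ter G w)
    obtain ⟨v, hv, hvc, hceq⟩ := exists_mem_leg_colour hG hg hk hw hu hi
    refine ⟨⟨v, hvc⟩, distinguishes_of_unique hvc (fun z' hz' => ?_) (hall u hu v hv)⟩
    rcases eq_or_of_colour_eq hG hg hw hu hv (hceq ▸ hz') with h | h
    · exact h
    · omega
  · -- every class but that of `none` is a singleton, and a third leg makes up for the vertex `z₀`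
    have hw : w ∈ extMajor G := by rw [hMw]; rfl
    have hter := three_le_ter_of_extMajor_eq_singleton hG hMw
    set F := legColours G k w 0 ∪ legColours G k w 1 ∪ legColours G k w 2
    have hdisj : Disjoint (legColours G k w 0 ∪ legColours G k w 1) (legColours G k w 2) :=
      Finset.disjoint_union_left.2
        ⟨disjoint_legColours w (by omega), disjoint_legColours w (by omega)⟩
    have hF : F.card = k + quota G k w 2 := by
      rw [Finset.card_union_of_disjoint hdisj,
        Finset.card_union_of_disjoint (disjoint_legColours w zero_ne_one), card_legColours,
        card_legColours, card_legColours, quota_zero_add_quota_one]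
    have hq : k ≤ 2 * quota G k w 2 := by
      simp only [quota, two_ne_zero, if_false]
      omega
    have hcard : k ≤ (F.filter fun c => colour G k g z₀ ≠ some c).card := by
      have h1 := Finset.card_filter_add_card_filter_not (s := F)
        (fun c => colour G k g z₀ ≠ some c)
      have h2 : (F.filter fun c => ¬ colour G k g z₀ ≠ some c).card ≤ 1 := by
        rw [Finset.card_le_one]
        intro c hc c' hc'
        simp only [Finset.mem_filter, not_not] at hc hc'
        exact Option.some_inj.1 (hc.2.symm.trans hc'.2)
      omega
    refine (Nat.cast_le.2 hcard).trans (card_le_encard_distinguishing _ fun c hc => ?_)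
    rw [Finset.mem_filter] at hc
    have hi : ∃ i < 3, c ∈ legColours G k w i := by
      rcases Finset.mem_union.1 hc.1 with h | h
      · rcases Finset.mem_union.1 h with h | h
        · exact ⟨0, by omega, h⟩
        · exact ⟨1, by omega, h⟩
      · exact ⟨2, by omega, h⟩
    obtain ⟨i, hi3, hi⟩ := hi
    obtain ⟨u, hu, rfl⟩ := (hg w hw).1.surjOn (lt_of_lt_of_le hi3 hter : i < ter G w)
    obtain ⟨v, hv, hvc, hceq⟩ := exists_mem_leg_colour hG hg hk hw hu hi
    refine ⟨⟨v, hvc⟩, distinguishes_of_unique hvc (fun z' hz' => ?_) (hne v ?_)⟩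
    · rcases eq_or_of_colour_eq hG hg hw hu hv (hceq ▸ hz') with h | ⟨-, w', hw', hww, -⟩
      · exact h
      · rw [hMw] at hw'
        exact absurd hw' hww
    · rintro rfl
      exact hc.2 hvc
  · -- all colours of the two legs
    have hne : g w u ≠ g w u' := fun h => huu ((hg w hw).1.injOn hu hu' h)
    have hcard : k ≤ (legColours G k w (g w u) ∪ legColours G k w (g w u')).card := by
      rw [Finset.card_union_of_disjoint (disjoint_legColours w hne), card_legColours,
        card_legColours]
      exact le_quota_add_quota k w hne
    refine (Nat.cast_le.2 hcard).trans (card_le_encard_distinguishing _ fun c hc => ?_)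
    rcases Finset.mem_union.1 hc with h | h
    · obtain ⟨z, hz, hzc, hceq⟩ := exists_mem_leg_colour hG hg hk hw hu h
      exact ⟨⟨z, hzc⟩, (distinguishes_of_mem_leg hG hg hw hu' hu huu.symm hy hx hd.symm hz hzc
        hceq).symm⟩
    · obtain ⟨z, hz, hzc, hceq⟩ := exists_mem_leg_colour hG hg hk hw hu' h
      exact ⟨⟨z, hzc⟩, distinguishes_of_mem_leg hG hg hw hu hu' huu hx hy hd hz hzc hceq⟩

theorem encard_colourClasses_le (hG : G.IsTree) (hg : IsLegNumbering G g) :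
    (colourClasses G k g).encard ≤ ((k * (extMajor G).ncard + bigI G k + 1 : ℕ) : ℕ∞) := by
  classical
  set M := (Set.toFinite (extMajor G)).toFinset
  set B : Finset (Option V × ℕ × ℕ) :=
    M.biUnion (fun w => legColours G k w 0 ∪ legColours G k w 1) ∪ {none} ×ˢ sharedPairs G k
  have hB : B.card ≤ k * (extMajor G).ncard + bigI G k := by
    refine (Finset.card_union_le _ _).trans (Nat.add_le_add ?_ ?_)
    · rw [mul_comm, Set.ncard_eq_toFinset_card (extMajor G)]
      refine Finset.card_biUnion_le_card_mul _ _ _ fun w _ => (Finset.card_union_le _ _).trans ?_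
      rw [card_legColours, card_legColours, quota_zero_add_quota_one]
    · rw [Finset.card_product, Finset.card_singleton, one_mul]
      exact card_sharedPairs_le k
  have hmem : ∀ v c, colour G k g v = some c → c ∈ B := by
    intro v c hc
    obtain ⟨w, hw, u, hu, hv, hq, rfl⟩ := (colour_eq_some_iff hG).1 hc
    have hpos := hG.connected.pos_dist_of_ne hv.1
    have hter : g w u < ter G w := (hg w hw).1.mapsTo hu
    by_cases hi : g w u < 2
    · refine Finset.mem_union_left _ (Finset.mem_biUnion.2 ⟨w, ?_, ?_⟩)
      · exact (Set.Finite.mem_toFinset _).2 hw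
      have : (legTag w (g w u), g w u, G.dist v w) ∈ legColours G k w (g w u) :=
        mem_legColours.2 ⟨_, hpos, hq, rfl⟩
      rcases (by omega : g w u = 0 ∨ g w u = 1) with h | h
      · rw [h] at this ⊢
        exact Finset.mem_union_left _ this
      · rw [h] at this ⊢
        exact Finset.mem_union_right _ this
    · refine Finset.mem_union_right _ (Finset.mem_product.2 ⟨?_, ?_⟩)
      · simp [legTag, hi]
      · rw [quota, if_neg (by omega)] at hq
        exact mem_sharedPairs hw (by omega) hter hpos hq
  have hcover : colourClasses G k g ⊆
      (fun c => {v | colour G k g v = c}) '' (Finset.insertNone B : Finset _) := by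
    rintro S ⟨v, rfl⟩
    refine ⟨colour G k g v, ?_, rfl⟩
    rw [Finset.mem_coe, Finset.mem_insertNone]
    exact fun c hc => hmem v c hc
  refine (Set.encard_le_encard hcover).trans ((Set.encard_image_le _ _).trans ?_)
  rw [Set.encard_coe_eq_coe_finsetCard, Finset.card_insertNone, Nat.cast_le]
  omega

end Colouring

end PartDim

/-! ### The bound -/

theorem mainTheorem1 {V : Type*} [Fintype V] (T : SimpleGraph V) [DecidableRel T.Adj]
    (hT : T.IsTree) (hpath : ∀ n : ℕ, IsEmpty (T ≃g SimpleGraph.pathGraph n))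
    (k : ℕ) (hk : 1 ≤ k) (hk' : k ≤ PartDim.sigma T) :
    PartDim.pd T k ≤ ((k * (PartDim.extMajor T).ncard + PartDim.bigI T k + 1 : ℕ) : ℕ∞) := by
  obtain ⟨g, hg⟩ := PartDim.exists_isLegNumbering (G := T)
  have hM := PartDim.extMajor_nonempty (hk.trans hk')
  have hgen : PartDim.IsKPartitionGenerator T k (PartDim.colourClasses T k g) :=
    ⟨Setoid.isPartition_classes _,
      fun _ _ hxy => PartDim.le_encard_distinguishing hT hg hk' hM hxy⟩
  exact (iInf₂_le _ hgen).trans (PartDim.encard_colourClasses_le hT hg)
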